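/- Let $d\in\mathbb N$, let $\Omega\subset\mathbb R^d$ be open, let $\Gamma_D\subset\partial\Omega$, and let $V=\{\mathbf v\in H^1(\Omega;\mathbb R^d):\mathbf v|_{\Gamma_D}=0\}$ with the norm $\|\mathbf v\|_1^2=\|\mathbf v\|_{L^2}^2+\|\nabla\mathbf v\|_{L^2}^2$. Let $\mathcal T_h$ be a finite set of closed non-degenerate $d$-simplices $K$ (the macro cells) with $\bigcup_{K\in\mathcal T_h}K=\overline\Omega$ and pairwise disjoint interiors. For a vertex $v_i$ of $\mathcal T_h$ let $\mathrm{MacroStar}(v_i)$ be the union of all macro cells containing $v_i$. Let $V_h\subset V$ and $Q_h\subset L^2(\Omega)$ be finite-dimensional subspaces, and put $$\tilde Q_h=\{q\in L^2(\Omega): q|_K \text{ is constant for all } K\in\mathcal T_h\},\qquad V_i=\{\mathbf v\in V_h:\operatorname{supp}\mathbf v\subset\mathrm{MacroStar}(v_i)\}.$$ Supports are those of functions defined almost everywhere on $\Omega$, taken in $\overline\Omega$. For $K\in\mathcal T_h$ let $V_{h,0}(K)$ be the space of those $\mathbf v\in V_h$ that vanish outside $K$ and satisfy $\mathbf v|_K\in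 H^1_0(K;\mathbb R^d)$, and let $Q_h(K)=\{q|_K-|K|^{-1}\int_K q\,dx: q\in Q_h\}$ be the space of mean-zero discrete pressures on $K$ (should $K\cap\Omega$ differ from $K$ in more than boundary points of $K$, then $|K|$, the integrals over $K$ and $H^1_0(K)$ are understood on $K\cap\Omega$ and its interior). For a subspace $Q\subset L^2(\Omega)$, a Fortin operator for $V_h\times Q$ is a continuous linear map $I:V\to V_h$ such that $(q,\nabla\cdot I(\mathbf v))=(q,\nabla\cdot\mathbf v)$ for all $q\in Q$, $\mathbf v\in V$, and $I(\mathbf v_h)=\mathbf v_h$ for all $\mathbf v_h\in V_h$. Let $\{\Omega_i\}$, indexed by the vertices $v_i$ of $\mathcal T_h$, be a covering of $\Omega$ with $\Omega_i\subset\mathrm{MacroStar}(v_i)$. Assume that * there is a Fortin operator $\tilde I_h$ for $V_h\times\tilde Q_h$ such that, for every vertex $v_i$, $\tilde I_h(\mathbf v)\in V_i$ for all $\mathbf v\in V$ with $\operatorname{supp}\mathbf v\subset\Omega_i$; * the pair is inf-sup stable on each macro cell: there is $\beta>0$ such that for every $K\in\mathcal T_h$ and every $q\in Q_h(K)$, $$\beta\,\|q\|_{L^2(K)}\le\sup_{\mathbf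 v\in V_{h,0}(K)}\frac{(q,\nabla\cdot\mathbf v)_{L^2(K)}}{\|\mathbf v\|_1}\qquad(\text{with } 0/0:=0).$$ Then there is a Fortin operator $I_h$ for $V_h\times Q_h$ such that, for the same covering and every vertex $v_i$, $I_h(\mathbf v)\in V_i$ for all $\mathbf v\in V$ with $\operatorname{supp}\mathbf v\subset\Omega_i$. Moreover the continuity constant of $I_h$ is bounded by a number that depends only on $d$, on $\beta$ and on the continuity constant of $\tilde I_h$ (in particular not on the mesh or on the spaces $V_h$, $Q_h$). -/

import Mathlib

open MeasureTheory Filter Topology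
open scoped ContDiff

noncomputable section

namespace MacroFortin

/-- `ℝ^d` with its Euclidean norm. -/
abbrev Space (d : ℕ) : Type := EuclideanSpace ℝ (Fin d)

/-! ### Sobolev spaces -/

/-- `L²(Ω; ℝ^d)`. -/
abbrev L2Vec {d : ℕ} (Ω : Set (Space d)) : Type :=
  Lp (Space d) 2 (volume.restrict Ω)

/-- `L²(Ω; ℝ^{d×d})`, with the Frobenius norm on matrices. -/
abbrev L2Mat {d : ℕ} (Ω : Set (Space d)) : Type :=
  Lp (EuclideanSpace ℝ (Fin d × Fin d)) 2 (volume.restrict Ω)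

/-- `L²(Ω)`, the space in which the pressures live. -/
abbrev L2 {d : ℕ} (Ω : Set (Space d)) : Type :=
  Lp ℝ 2 (volume.restrict Ω)

/-- `G` is the weak gradient of `u` on `Ω`: `G (i, j) = ∂u_i / ∂x_j` in the sense of distributions. -/
def IsWeakGradient {d : ℕ} (Ω : Set (Space d)) (u : Space d → Space d)
    (G : Space d → EuclideanSpace ℝ (Fin d × Fin d)) : Prop :=
  ∀ φ : Space d → ℝ, ContDiff ℝ ∞ φ → HasCompactSupport φ → tsupport φ ⊆ Ω → ∀ i j : Fin d,
    ∫ x in Ω, u x i * fderiv ℝ φ x (EuclideanSpace.single j 1) = - ∫ x in Ω, G x (i, j) * φ x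

theorem integrable_coord_mul {d : ℕ} {ι : Type*} [Fintype ι] {Ω : Set (Space d)}
    (u : Lp (EuclideanSpace ℝ ι) 2 (volume.restrict Ω)) (i : ι) {ψ : Space d → ℝ}
    (hψ : Continuous ψ) (hc : HasCompactSupport ψ) :
    Integrable (fun x => u x i * ψ x) (volume.restrict Ω) := by
  have h1 : MemLp (fun x => u x i) 2 (volume.restrict Ω) :=
    (EuclideanSpace.proj (𝕜 := ℝ) i).comp_memLp' (Lp.memLp u)
  have h2 : MemLp ψ 2 (volume.restrict Ω) := hψ.memLp_of_hasCompactSupport hc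
  exact h1.integrable_mul h2

/-- The Sobolev space `H¹(Ω; ℝ^d)`, realised as the space of pairs `(u, ∇u) ∈ L² × L²` where `∇u`
is the (unique) weak gradient of `u`. The norm it inherits from the Hilbert sum is
`‖u‖₁² = ‖u‖₀² + ‖∇u‖₀²`. -/
def H1 {d : ℕ} (Ω : Set (Space d)) : Submodule ℝ (WithLp 2 (L2Vec Ω × L2Mat Ω)) where
  carrier := {w | IsWeakGradient Ω w.fst w.snd}
  zero_mem' := by
    intro φ hφ hc hs i j
    have h1 : ∀ᵐ x ∂(volume.restrict Ω), ((0 : L2Vec Ω) : Space d → Space d) x i *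
        fderiv ℝ φ x (EuclideanSpace.single j 1) = 0 := by
      filter_upwards [Lp.coeFn_zero (Space d) 2 (volume.restrict Ω)] with x hx
      rw [hx]
      simp
    have h2 : ∀ᵐ x ∂(volume.restrict Ω),
        ((0 : L2Mat Ω) : Space d → EuclideanSpace ℝ (Fin d × Fin d)) x (i, j) * φ x = 0 := by
      filter_upwards [Lp.coeFn_zero (EuclideanSpace ℝ (Fin d × Fin d)) 2
        (volume.restrict Ω)] with x hx
      rw [hx]
      simp
    change ∫ x in Ω, ((0 : L2Vec Ω) : Space d → Space d) x i *
        fderiv ℝ φ x (EuclideanSpace.single j 1) = - ∫ x in Ω,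
        ((0 : L2Mat Ω) : Space d → EuclideanSpace ℝ (Fin d × Fin d)) x (i, j) * φ x
    rw [integral_congr_ae h1, integral_congr_ae h2]
    simp
  add_mem' := by
    intro a b ha hb φ hφ hc hs i j
    have hd : Continuous (fun x => fderiv ℝ φ x (EuclideanSpace.single j 1)) :=
      (hφ.continuous_fderiv (by simp)).clm_apply continuous_const
    have hdc : HasCompactSupport (fun x => fderiv ℝ φ x (EuclideanSpace.single j 1)) :=
      hc.fderiv_apply ℝ _
    have h1 : ∀ᵐ x ∂(volume.restrict Ω), (a + b).fst x i *
        fderiv ℝ φ x (EuclideanSpace.single j 1) =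
        a.fst x i * fderiv ℝ φ x (EuclideanSpace.single j 1) +
        b.fst x i * fderiv ℝ φ x (EuclideanSpace.single j 1) := by
      filter_upwards [Lp.coeFn_add a.fst b.fst] with x hx
      rw [WithLp.add_fst, hx]
      simp [add_mul]
    have h2 : ∀ᵐ x ∂(volume.restrict Ω), (a + b).snd x (i, j) * φ x =
        a.snd x (i, j) * φ x + b.snd x (i, j) * φ x := by
      filter_upwards [Lp.coeFn_add a.snd b.snd] with x hx
      rw [WithLp.add_snd, hx]
      simp [add_mul]
    rw [integral_congr_ae h1, integral_congr_ae h2,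
      integral_add (integrable_coord_mul _ _ hd hdc) (integrable_coord_mul _ _ hd hdc),
      integral_add (integrable_coord_mul _ _ hφ.continuous hc)
        (integrable_coord_mul _ _ hφ.continuous hc),
      ha φ hφ hc hs i j, hb φ hφ hc hs i j, neg_add]
  smul_mem' := by
    intro c a ha φ hφ hc hs i j
    have h1 : ∀ᵐ x ∂(volume.restrict Ω), (c • a).fst x i *
        fderiv ℝ φ x (EuclideanSpace.single j 1) =
        c * (a.fst x i * fderiv ℝ φ x (EuclideanSpace.single j 1)) := by
      filter_upwards [Lp.coeFn_smul c a.fst] with x hx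
      rw [WithLp.smul_fst, hx]
      simp [mul_assoc]
    have h2 : ∀ᵐ x ∂(volume.restrict Ω), (c • a).snd x (i, j) * φ x =
        c * (a.snd x (i, j) * φ x) := by
      filter_upwards [Lp.coeFn_smul c a.snd] with x hx
      rw [WithLp.smul_snd, hx]
      simp [mul_assoc]
    rw [integral_congr_ae h1, integral_congr_ae h2, integral_const_mul, integral_const_mul,
      ha φ hφ hc hs i j, mul_neg]

/-- The function underlying an element of `H¹(Ω; ℝ^d)`. -/
def toFun {d : ℕ} {Ω : Set (Space d)} (v : H1 Ω) : Space d → Space d :=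
  (v : WithLp 2 (L2Vec Ω × L2Mat Ω)).fst

/-- The weak gradient of an element of `H¹(Ω; ℝ^d)`. -/
def grad {d : ℕ} {Ω : Set (Space d)} (v : H1 Ω) : Space d → EuclideanSpace ℝ (Fin d × Fin d) :=
  (v : WithLp 2 (L2Vec Ω × L2Mat Ω)).snd

/-- The divergence `∇·v = ∑ᵢ ∂vᵢ/∂xᵢ`. -/
def divergence {d : ℕ} {Ω : Set (Space d)} (v : H1 Ω) : Space d → ℝ :=
  fun x => ∑ i, grad v x (i, i)

/-- `v` has zero trace on `Γ ⊆ ∂Ω`: at almost every point of `Γ` with respect to surface measure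
(`(d-1)`-dimensional Hausdorff measure), the boundary value of `v`, that is the limit of its
averages over `B(x, r) ∩ Ω` as `r → 0`, exists and is zero. -/
def HasZeroTrace {d : ℕ} {Ω : Set (Space d)} (Γ : Set (Space d)) (v : H1 Ω) : Prop :=
  ∀ᵐ x ∂(Measure.hausdorffMeasure ((d : ℝ) - 1) : Measure (Space d)), x ∈ Γ →
    Tendsto (fun r : ℝ => ⨍ y in Metric.ball x r ∩ Ω, ‖toFun v y‖) (𝓝[>] 0) (𝓝 0)

theorem restrict_ball_le {d : ℕ} (Ω : Set (Space d)) (x : Space d) (r : ℝ) :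
    volume.restrict (Metric.ball x r ∩ Ω) ≤ volume.restrict Ω :=
  Measure.restrict_mono_set _ Set.inter_subset_right

theorem integrable_norm_ball {d : ℕ} {Ω : Set (Space d)} (v : H1 Ω) (x : Space d) (r : ℝ) :
    Integrable (fun y => ‖toFun v y‖) (volume.restrict (Metric.ball x r ∩ Ω)) := by
  have h : MemLp (toFun v) 2 (volume.restrict (Metric.ball x r ∩ Ω)) :=
    (Lp.memLp (v : WithLp 2 (L2Vec Ω × L2Mat Ω)).fst).mono_measure (restrict_ball_le Ω x r)
  have : IsFiniteMeasure (volume.restrict (Metric.ball x r ∩ Ω)) :=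
    ⟨by
      rw [Measure.restrict_apply_univ]
      exact (measure_mono Set.inter_subset_left).trans_lt measure_ball_lt_top⟩
  exact (h.integrable (by norm_num)).norm

/-- The velocity space `V = {v ∈ H¹(Ω; ℝ^d) : v = 0 on Γ_D}`. -/
def velocitySpace {d : ℕ} (Ω ΓD : Set (Space d)) : Submodule ℝ (H1 Ω) where
  carrier := {v | HasZeroTrace ΓD v}
  zero_mem' := by
    change HasZeroTrace ΓD 0
    refine Eventually.of_forall fun x _ => ?_
    have h : ∀ r : ℝ, ⨍ y in Metric.ball x r ∩ Ω, ‖toFun (0 : H1 Ω) y‖ = 0 := by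
      intro r
      have : ∀ᵐ y ∂(volume.restrict (Metric.ball x r ∩ Ω)), ‖toFun (0 : H1 Ω) y‖ = 0 := by
        have h0 := Lp.coeFn_zero (Space d) 2 (volume.restrict Ω)
        filter_upwards [ae_mono (restrict_ball_le Ω x r) h0] with y hy
        change ‖((0 : L2Vec Ω) : Space d → Space d) y‖ = 0
        rw [hy]
        simp
      rw [average_congr this]
      simp [average]
    simp only [h]
    exact tendsto_const_nhds
  add_mem' := by
    intro a b ha hb
    change HasZeroTrace ΓD (a + b)
    filter_upwards [show HasZeroTrace ΓD a from ha, show HasZeroTrace ΓD b from hb] with x hax hbx hx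
    have hlim := (hax hx).add (hbx hx)
    rw [add_zero] at hlim
    refine squeeze_zero (fun r => ?_) (fun r => ?_) hlim
    · rw [setAverage_eq]
      exact smul_nonneg (by positivity) (integral_nonneg fun _ => norm_nonneg _)
    · simp only [setAverage_eq, smul_eq_mul]
      rw [← mul_add, ← integral_add (integrable_norm_ball a x r) (integrable_norm_ball b x r)]
      refine mul_le_mul_of_nonneg_left ?_ (by positivity)
      refine integral_mono_ae (integrable_norm_ball _ x r)
        ((integrable_norm_ball a x r).add (integrable_norm_ball b x r)) ?_
      have h0 := Lp.coeFn_add (a : WithLp 2 (L2Vec Ω × L2Mat Ω)).fst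
        (b : WithLp 2 (L2Vec Ω × L2Mat Ω)).fst
      filter_upwards [ae_mono (restrict_ball_le Ω x r) h0] with y hy
      have : toFun (a + b) y = toFun a y + toFun b y := hy
      rw [this]
      exact norm_add_le _ _
  smul_mem' := by
    intro c a ha
    change HasZeroTrace ΓD (c • a)
    filter_upwards [show HasZeroTrace ΓD a from ha] with x hax hx
    have hlim := (hax hx).const_mul |c|
    rw [mul_zero] at hlim
    refine hlim.congr fun r => ?_
    simp only [setAverage_eq, smul_eq_mul]
    rw [mul_left_comm, ← integral_const_mul]
    congr 1
    refine integral_congr_ae ?_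
    have h0 := Lp.coeFn_smul c (a : WithLp 2 (L2Vec Ω × L2Mat Ω)).fst
    filter_upwards [ae_mono (restrict_ball_le Ω x r) h0] with y hy
    have : toFun (c • a) y = c • toFun a y := hy
    rw [this, norm_smul, Real.norm_eq_abs]

/-- The support of (the equivalence class of) a function on `Ω`: the complement of the largest open
set on which the function vanishes almost everywhere. -/
def supp {d : ℕ} {Ω : Set (Space d)} (v : H1 Ω) : Set (Space d) :=
  {x | ∀ U ∈ 𝓝 x, ¬ ∀ᵐ y ∂(volume.restrict Ω), y ∈ U → toFun v y = 0}

/-- The closure in `H¹(Ω; ℝ^d)` of the smooth vector fields with compact support in `U ∩ Ω`, that is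
`H¹₀(U ∩ Ω; ℝ^d)`, extended by zero. -/
def H10 {d : ℕ} (Ω U : Set (Space d)) : Set (H1 Ω) :=
  closure {v | ∃ φ : Space d → Space d, ContDiff ℝ ∞ φ ∧ HasCompactSupport φ ∧
    tsupport φ ⊆ U ∩ Ω ∧ ∀ᵐ x ∂(volume.restrict Ω), toFun v x = φ x}

/-! ### The macro mesh -/

/-- The closed simplex spanned by a finite set of vertices. -/
def cell {d : ℕ} (K : Finset (Space d)) : Set (Space d) := convexHull ℝ (K : Set (Space d))

/-- A simplicial macro mesh of `Ω`: finitely many non-degenerate closed `d`-simplices, each given by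
its set of `d + 1` vertices, with union `closure Ω` and pairwise disjoint interiors. -/
structure MacroMesh {d : ℕ} (Ω : Set (Space d)) where
  cells : Finset (Finset (Space d))
  card_eq : ∀ K ∈ cells, K.card = d + 1
  affineIndependent : ∀ K ∈ cells, AffineIndependent ℝ ((↑) : K → Space d)
  iUnion_eq : ⋃ K ∈ cells, cell K = closure Ω
  disjoint_interior : ∀ K ∈ cells, ∀ L ∈ cells, K ≠ L →
    Disjoint (interior (cell K)) (interior (cell L))

/-- The vertices of the macro mesh. -/
def MacroMesh.vertices {d : ℕ} {Ω : Set (Space d)} (T : MacroMesh Ω) : Set (Space d) :=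
  {p | ∃ K ∈ T.cells, p ∈ K}

/-- `MacroStar(p)`: the union of all macro cells touching `p`. -/
def MacroMesh.macroStar {d : ℕ} {Ω : Set (Space d)} (T : MacroMesh Ω) (p : Space d) :
    Set (Space d) :=
  {x | ∃ K ∈ T.cells, p ∈ cell K ∧ x ∈ cell K}

/-- The space of pressures in `L²(Ω)` that are constant on every macro cell. -/
def MacroMesh.piecewiseConstant {d : ℕ} {Ω : Set (Space d)} (T : MacroMesh Ω) :
    Submodule ℝ (L2 Ω) where
  carrier := {q | ∀ K ∈ T.cells, ∃ c : ℝ, ∀ᵐ x ∂(volume.restrict Ω), x ∈ cell K → q x = c}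
  zero_mem' := by
    intro K _
    refine ⟨0, ?_⟩
    filter_upwards [Lp.coeFn_zero ℝ 2 (volume.restrict Ω)] with x hx _
    rw [hx]
    rfl
  add_mem' := by
    intro a b ha hb K hK
    obtain ⟨c, hc⟩ := ha K hK
    obtain ⟨e, he⟩ := hb K hK
    refine ⟨c + e, ?_⟩
    filter_upwards [hc, he, Lp.coeFn_add a b] with x h1 h2 h3 hx
    rw [h3, Pi.add_apply, h1 hx, h2 hx]
  smul_mem' := by
    intro t a ha K hK
    obtain ⟨c, hc⟩ := ha K hK
    refine ⟨t * c, ?_⟩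
    filter_upwards [hc, Lp.coeFn_smul t a] with x h1 h3 hx
    rw [h3, Pi.smul_apply, h1 hx, smul_eq_mul]

/-! ### Fortin operators, locality and local stability -/

/-- A continuous linear map `I : V → V_h` is a Fortin operator for the pair `V_h × Q` if it is the
identity on `V_h` and preserves the divergence tested against `Q`. -/
structure IsFortin {d : ℕ} {Ω ΓD : Set (Space d)} {Vh : Submodule ℝ (H1 Ω)}
    (I : velocitySpace Ω ΓD →L[ℝ] Vh) (Q : Submodule ℝ (L2 Ω)) : Prop where
  div_eq : ∀ q ∈ Q, ∀ v : velocitySpace Ω ΓD,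
    ∫ x in Ω, q x * divergence (I v : H1 Ω) x = ∫ x in Ω, q x * divergence (v : H1 Ω) x
  proj : ∀ v : velocitySpace Ω ΓD, (v : H1 Ω) ∈ Vh → (I v : H1 Ω) = v

/-- The macro-star space `V_p = {v ∈ V_h : supp v ⊆ MacroStar(p)}`. -/
def MacroMesh.starSpace {d : ℕ} {Ω : Set (Space d)} (T : MacroMesh Ω)
    (Vh : Submodule ℝ (H1 Ω)) (p : Space d) : Set (H1 Ω) :=
  {v | v ∈ Vh ∧ supp v ⊆ T.macroStar p}

/-- For every macro vertex `p`, the operator maps fields of `V` supported in `Ωc p` into `V_p`. -/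
def IsLocal {d : ℕ} {Ω ΓD : Set (Space d)} (T : MacroMesh Ω) {Vh : Submodule ℝ (H1 Ω)}
    (Ωc : Space d → Set (Space d)) (I : velocitySpace Ω ΓD →L[ℝ] Vh) : Prop :=
  ∀ p ∈ T.vertices, ∀ v : velocitySpace Ω ΓD, supp (v : H1 Ω) ⊆ Ωc p →
    (I v : H1 Ω) ∈ T.starSpace Vh p

/-- `V_{h,0}(K)`: the discrete velocities supported in the macro cell `K` and vanishing on its
boundary. -/
def localVelocities {d : ℕ} {Ω : Set (Space d)} (Vh : Submodule ℝ (H1 Ω))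
    (K : Finset (Space d)) : Set (H1 Ω) :=
  {v | v ∈ Vh ∧ v ∈ H10 Ω (interior (cell K))}

/-- `Q_h(K)`: the mean-zero parts on the macro cell `K` of the discrete pressures. Only the values
on `K` of these functions matter. -/
def localPressures {d : ℕ} {Ω : Set (Space d)} (Qh : Submodule ℝ (L2 Ω))
    (K : Finset (Space d)) : Set (Space d → ℝ) :=
  {r | ∃ q ∈ Qh, r = fun x => q x - ⨍ y in cell K ∩ Ω, q y}

/-- The pair `V_{h,0}(K) × Q_h(K)` is inf-sup stable with constant `β`:
`β ‖r‖_{L²(K)} ≤ sup_v (r, ∇·v)_K / ‖v‖₁` for all `r ∈ Q_h(K)`, with the convention `0 / 0 = 0` for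
`v = 0`. A field in `V_{h,0}(K)` vanishes off `K`, so its `H¹(K)` and `H¹(Ω)` norms agree. -/
def InfSupStableOn {d : ℕ} {Ω : Set (Space d)} (Vh : Submodule ℝ (H1 Ω)) (Qh : Submodule ℝ (L2 Ω))
    (β : ℝ) (K : Finset (Space d)) : Prop :=
  ∀ r ∈ localPressures Qh K,
    β * Real.sqrt (∫ x in cell K ∩ Ω, r x ^ 2) ≤
      ⨆ v : localVelocities Vh K,
        (∫ x in cell K ∩ Ω, r x * divergence (v : H1 Ω) x) / ‖(v : H1 Ω)‖

end MacroFortin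

end

open MacroFortin

/-!
The operator is `I v = J v + R (∇·(v - J v))`, where `J` is the given operator for piecewise constant
pressures and `R` adds to `J v` a correction on each macro cell.

On a cell `K`, the inf-sup condition says that the adjoint of the divergence, restricted to
`V_{h,0}(K)` and tested with the mean-free pressures `Q_h(K)`, is bounded below by `β`. Hence the
equation `(r, ∇·u) = (r, f)` for all `r ∈ Q_h(K)` has a solution `u ∈ V_{h,0}(K)` that is linear in
`f` and satisfies `‖u‖₁ ≤ β⁻¹ ‖f‖` (`exists_rightInverse_of_infSup`, `exists_cellCorrection`). The sum
of these solutions over the cells is `R f`. The fields belonging to different cells are orthogonal in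
`H¹`, so that `‖R f‖₁ ≤ β⁻¹ ‖f‖` without reference to the mesh (`exists_correction`).

Let `w = v - J v`. A discrete pressure is on each cell the sum of a mean-free part and a constant.
The mean-free part sees the same divergence in `R (∇·w)` as in `w`, by construction. The constant sees
none in either: `∫_K ∇·w = 0` because `J` preserves the divergence tested with the indicator of `K`
(`integral_resL_divL_sub_eq_zero`), and `∫_K ∇·u = 0` for `u ∈ H¹₀(K)` by the divergence theorem
(`integral_resL_divL_eq_zero`). So `I` preserves the divergence tested with `Q_h`. If `v ∈ V_h`, then
`w = 0` and `I v = v`. If `v` and `J v` are supported in the star of a vertex, then `∇w` vanishes on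
every cell outside the star (`grad_ae_zero_of_toFun_ae_zero`), no correction is made there, and `I v`
is supported in the star. Finally `‖∇·w‖ ≤ √d ‖w‖₁`, which gives the constant
`‖J‖ + β⁻¹ √d (1 + ‖J‖)`.
-/

noncomputable section

namespace MacroFortin

/-! ### Solving a constrained problem by duality -/

/-- If `D : E → F` satisfies an inf-sup condition with constant `β` against the finite-dimensional
test space `M ⊆ F`, then the equation `(m, D x) = (m, f)` for all `m ∈ M` has a solution `x = R f`
that depends linearly on `f` and satisfies `‖R f‖ ≤ β⁻¹ ‖f‖`. With `A = P_M D`, the solution is the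
one of least norm, `R = A* (A A*)⁻¹ P_M`. -/
theorem exists_rightInverse_of_infSup {E F : Type*} [NormedAddCommGroup E] [InnerProductSpace ℝ E]
    [FiniteDimensional ℝ E] [NormedAddCommGroup F] [InnerProductSpace ℝ F]
    (D : E →L[ℝ] F) (M : Submodule ℝ F) [FiniteDimensional ℝ M] {β : ℝ} (hβ : 0 < β)
    (h : ∀ m ∈ M, ∀ c : ℝ, 0 ≤ c → (∀ x, inner ℝ m (D x) ≤ c * ‖x‖) → β * ‖m‖ ≤ c) :
    ∃ R : F →L[ℝ] E, (∀ f, ∀ m ∈ M, inner ℝ m (D (R f)) = inner ℝ m f) ∧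
      ∀ f, ‖R f‖ ≤ β⁻¹ * ‖f‖ := by
  have : CompleteSpace E := FiniteDimensional.complete ℝ E
  have : CompleteSpace M := FiniteDimensional.complete ℝ M
  let P : F →L[ℝ] M := M.orthogonalProjectionOnto
  have hP : ∀ (m : M) (f : F), inner ℝ m (P f) = inner ℝ (m : F) f := fun m f =>
    M.inner_orthogonalProjectionOnto_eq_of_mem_left m f
  let A : E →L[ℝ] M := P ∘L D
  let B : M →L[ℝ] E := ContinuousLinearMap.adjoint A
  have hB : ∀ (m : M) (x : E), inner ℝ (B m) x = inner ℝ (m : F) (D x) := fun m x => by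
    rw [ContinuousLinearMap.adjoint_inner_left]
    exact hP m (D x)
  have hlow : ∀ m : M, β * ‖m‖ ≤ ‖B m‖ := fun m => by
    refine h m m.2 _ (norm_nonneg _) fun x => ?_
    rw [← hB]
    exact real_inner_le_norm _ _
  let S : M →ₗ[ℝ] M := (A ∘L B : M →L[ℝ] M)
  have hS : ∀ m : M, inner ℝ m (S m) = ‖B m‖ ^ 2 := fun m => by
    rw [← real_inner_self_eq_norm_sq, ContinuousLinearMap.adjoint_inner_left]
    rfl
  have hinj : Function.Injective S := by
    rw [← LinearMap.ker_eq_bot, LinearMap.ker_eq_bot']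
    intro m hm
    have h0 : ‖B m‖ = 0 := by simpa [hm] using (hS m).symm
    have h1 := hlow m
    rw [h0] at h1
    exact norm_le_zero_iff.1 (nonpos_of_mul_nonpos_right h1 hβ)
  let e : M ≃ₗ[ℝ] M := LinearEquiv.ofInjectiveEndo S hinj
  let N : M →L[ℝ] M := (e.symm : M →ₗ[ℝ] M).toContinuousLinearMap
  have hN : ∀ m : M, S (N m) = m := fun m => e.apply_symm_apply m
  refine ⟨B ∘L N ∘L P, fun f m hm => ?_, fun f => ?_⟩
  · have h1 : P (D (B (N (P f)))) = P f := hN (P f)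
    change inner ℝ m (D (B (N (P f)))) = _
    rw [← hP ⟨m, hm⟩, h1, hP ⟨m, hm⟩]
  · change ‖B (N (P f))‖ ≤ _
    set y := N (P f)
    have h1 : ‖B y‖ ^ 2 ≤ ‖y‖ * ‖f‖ := by
      rw [← hS, hN, hP]
      exact real_inner_le_norm _ _
    have h2 := hlow y
    rw [inv_mul_eq_div, le_div_iff₀ hβ]
    rcases (norm_nonneg (B y)).eq_or_lt with h3 | h3
    · rw [← h3, zero_mul]
      exact norm_nonneg f
    · refine le_of_mul_le_mul_left ?_ h3
      nlinarith [norm_nonneg f]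

/-- The inf-sup solution operator for `D : H → F` on the fields of `V` that lie in `N`, tested with
the image of `Q` under `P`. -/
theorem exists_rightInverse_of_infSup_on {H G F : Type*} [NormedAddCommGroup H]
    [InnerProductSpace ℝ H] [NormedAddCommGroup G] [NormedSpace ℝ G] [NormedAddCommGroup F]
    [InnerProductSpace ℝ F] (D : H →L[ℝ] F) (V N : Submodule ℝ H) [FiniteDimensional ℝ V]
    (P : G →L[ℝ] F) (Q : Submodule ℝ G) [FiniteDimensional ℝ Q] {β : ℝ} (hβ : 0 < β)
    (h : ∀ q ∈ Q, ∀ c : ℝ, 0 ≤ c → (∀ v ∈ V, v ∈ N → inner ℝ (P q) (D v) ≤ c * ‖v‖) →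
      β * ‖P q‖ ≤ c) :
    ∃ R : F →L[ℝ] V, (∀ f, (R f : H) ∈ N) ∧
      (∀ f, ∀ q ∈ Q, inner ℝ (P q) (D (R f)) = inner ℝ (P q) f) ∧ ∀ f, ‖R f‖ ≤ β⁻¹ * ‖f‖ := by
  let E : Submodule ℝ V := N.comap V.subtype
  obtain ⟨R, hR, hRn⟩ := exists_rightInverse_of_infSup (E := E) (D ∘L V.subtypeL ∘L E.subtypeL)
    (Q.map (P : G →ₗ[ℝ] F)) hβ (by
      rintro _ ⟨q, hq, rfl⟩ c hc hb
      exact h q hq c hc fun v hv hvN => hb ⟨⟨v, hv⟩, hvN⟩)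
  exact ⟨E.subtypeL ∘L R, fun f => (R f).2, fun f q hq => hR f _ ⟨q, hq, rfl⟩, hRn⟩

/-! ### Fields in `H¹` that vanish on a set -/

section Sobolev

variable {d : ℕ} {Ω : Set (Space d)}

/-- The map `H¹ → L²` that forgets the gradient. -/
def fieldL (Ω : Set (Space d)) : H1 Ω →L[ℝ] L2Vec Ω :=
  WithLp.fstL 2 ℝ (L2Vec Ω) (L2Mat Ω) ∘L (H1 Ω).subtypeL

/-- The weak gradient as a continuous linear map `H¹ → L²`. -/
def gradL (Ω : Set (Space d)) : H1 Ω →L[ℝ] L2Mat Ω :=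
  WithLp.sndL 2 ℝ (L2Vec Ω) (L2Mat Ω) ∘L (H1 Ω).subtypeL

theorem toFun_eq_fieldL (v : H1 Ω) : toFun v = fieldL Ω v := rfl

theorem grad_eq_gradL (v : H1 Ω) : grad v = gradL Ω v := rfl

theorem toFun_add (v w : H1 Ω) :
    ∀ᵐ x ∂(volume.restrict Ω), toFun (v + w) x = toFun v x + toFun w x :=
  Lp.coeFn_add (fieldL Ω v) (fieldL Ω w)

theorem toFun_sub (v w : H1 Ω) :
    ∀ᵐ x ∂(volume.restrict Ω), toFun (v - w) x = toFun v x - toFun w x :=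
  Lp.coeFn_sub (fieldL Ω v) (fieldL Ω w)

theorem inner_eq (v w : H1 Ω) :
    inner ℝ v w = inner ℝ (fieldL Ω v) (fieldL Ω w) + inner ℝ (gradL Ω v) (gradL Ω w) :=
  rfl

theorem norm_gradL_le (v : H1 Ω) : ‖gradL Ω v‖ ≤ ‖v‖ := by
  have h := WithLp.prod_norm_sq_eq_of_L2 (v : WithLp 2 (L2Vec Ω × L2Mat Ω))
  have h2 : ‖v‖ ^ 2 = ‖fieldL Ω v‖ ^ 2 + ‖gradL Ω v‖ ^ 2 := h
  exact (sq_le_sq₀ (norm_nonneg _) (norm_nonneg _)).1 (by nlinarith [sq_nonneg ‖fieldL Ω v‖])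

/-- The trace of a matrix, as a functional on matrices with the Frobenius norm. -/
def traceL (d : ℕ) : EuclideanSpace ℝ (Fin d × Fin d) →L[ℝ] ℝ :=
  ∑ i, EuclideanSpace.proj (𝕜 := ℝ) (i, i)

theorem traceL_apply (G : EuclideanSpace ℝ (Fin d × Fin d)) : traceL d G = ∑ i, G (i, i) := by
  simp [traceL]

theorem norm_traceL_le : ‖traceL d‖ ≤ Real.sqrt d := by
  refine ContinuousLinearMap.opNorm_le_bound _ (Real.sqrt_nonneg _) fun G => ?_
  rw [EuclideanSpace.norm_eq, ← Real.sqrt_mul (Nat.cast_nonneg d), Real.norm_eq_abs, traceL_apply]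
  refine Real.abs_le_sqrt ?_
  calc (∑ i, G (i, i)) ^ 2 ≤ d * ∑ i, G (i, i) ^ 2 := by
        simpa using sq_sum_le_card_mul_sum_sq (s := Finset.univ) (f := fun i => G (i, i))
    _ ≤ d * ∑ p, ‖G p‖ ^ 2 := by
        refine mul_le_mul_of_nonneg_left ?_ (Nat.cast_nonneg d)
        rw [Fintype.sum_prod_type]
        refine Finset.sum_le_sum fun i _ => ?_
        refine le_trans (le_of_eq ?_)
          (Finset.single_le_sum (f := fun j => ‖G (i, j)‖ ^ 2) (fun j _ => sq_nonneg _)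
            (Finset.mem_univ i))
        simp

/-- The divergence as a continuous linear map `H¹ → L²`. -/
def divL (Ω : Set (Space d)) : H1 Ω →L[ℝ] L2 Ω :=
  (traceL d).compLpL 2 (volume.restrict Ω) ∘L gradL Ω

theorem divL_ae (v : H1 Ω) : divL Ω v =ᵐ[volume.restrict Ω] divergence v := by
  filter_upwards [(traceL d).coeFn_compLpL (gradL Ω v)] with x hx
  change (traceL d).compLpL 2 (volume.restrict Ω) (gradL Ω v) x = _
  rw [hx, traceL_apply]
  rfl

theorem norm_divL_le (v : H1 Ω) : ‖divL Ω v‖ ≤ Real.sqrt d * ‖v‖ :=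
  calc ‖divL Ω v‖ ≤ ‖traceL d‖ * ‖gradL Ω v‖ := (traceL d).norm_compLp_le _
    _ ≤ Real.sqrt d * ‖v‖ :=
      mul_le_mul norm_traceL_le (norm_gradL_le v) (norm_nonneg _) (Real.sqrt_nonneg _)

theorem grad_ae_zero_of_toFun_ae_zero {U : Set (Space d)} (hΩ : IsOpen Ω) (hU : IsOpen U) {v : H1 Ω}
    (hv : ∀ᵐ x ∂(volume.restrict Ω), x ∈ U → toFun v x = 0) :
    ∀ᵐ x ∂(volume.restrict Ω), x ∈ U → grad v x = 0 := by
  have key : ∀ p : Fin d × Fin d, ∀ᵐ x ∂(volume.restrict Ω), x ∈ U ∩ Ω → grad v x p = 0 := by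
    rintro ⟨i, j⟩
    have hmem : MemLp (fun x => grad v x (i, j)) 2 (volume.restrict Ω) :=
      (EuclideanSpace.proj (𝕜 := ℝ) (i, j)).comp_memLp' (Lp.memLp (gradL Ω v))
    refine (hU.inter hΩ).ae_eq_zero_of_integral_contDiff_smul_eq_zero
      ((hmem.locallyIntegrable (by norm_num)).locallyIntegrableOn _) fun g hg hgc hgs => ?_
    have h1 := v.2 g hg hgc (hgs.trans Set.inter_subset_right) i j
    have h2 : ∫ x in Ω, toFun v x i * fderiv ℝ g x (EuclideanSpace.single j 1) = 0 := by
      refine integral_eq_zero_of_ae ?_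
      filter_upwards [hv] with x hx
      by_cases hxg : x ∈ tsupport g
      · simp [hx (hgs hxg).1]
      · have : fderiv ℝ g x = 0 :=
          image_eq_zero_of_notMem_tsupport fun hx' => hxg (tsupport_fderiv_subset ℝ hx')
        simp [this]
    have h3 : ∫ x in Ω, grad v x (i, j) * g x = 0 := by
      have : (0 : ℝ) = - ∫ x in Ω, grad v x (i, j) * g x := h2.symm.trans h1
      linarith
    simpa [mul_comm] using h3
  filter_upwards [ae_all_iff.2 key, ae_restrict_mem hΩ.measurableSet] with x hx hxΩ hxU
  ext p
  exact hx p ⟨hxU, hxΩ⟩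

theorem isClosed_setOf_ae_zero_on {X E : Type*} [MeasurableSpace X] [NormedAddCommGroup E]
    [NormedSpace ℝ E] (μ : Measure X) {s : Set X} (hs : MeasurableSet s) :
    IsClosed {f : Lp E 2 μ | ∀ᵐ x ∂μ, x ∈ s → f x = 0} := by
  have : {f : Lp E 2 μ | ∀ᵐ x ∂μ, x ∈ s → f x = 0} =
      {f | LpToLpRestrictCLM X E ℝ μ 2 s f = 0} := by
    ext f
    have h := LpToLpRestrictCLM_coeFn ℝ s f
    rw [Set.mem_ofPred_eq, Set.mem_ofPred_eq, ← ae_restrict_iff' hs, Lp.eq_zero_iff_ae_eq_zero]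
    exact ⟨fun hf => h.trans hf, fun hf => h.symm.trans hf⟩
  rw [this]
  exact isClosed_singleton.preimage (LpToLpRestrictCLM X E ℝ μ 2 s).continuous

theorem supp_subset_of_ae_zero {S : Set (Space d)} (hS : IsClosed S) {v : H1 Ω}
    (hv : ∀ᵐ x ∂(volume.restrict Ω), x ∉ S → toFun v x = 0) : supp v ⊆ S := by
  intro x hx
  by_contra hxS
  exact hx Sᶜ (hS.isOpen_compl.mem_nhds hxS) hv

theorem ae_zero_of_supp_subset {S : Set (Space d)} {v : H1 Ω} (hv : supp v ⊆ S) :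
    ∀ᵐ x ∂(volume.restrict Ω), x ∉ S → toFun v x = 0 := by
  rw [ae_iff]
  refine measure_null_of_locally_null _ fun x hx => ?_
  have hxS : x ∉ supp v := fun h => hx fun hxS => absurd (hv h) hxS
  simp only [supp, Set.mem_ofPred_eq, not_forall, not_not] at hxS
  obtain ⟨U, hU, hUv⟩ := hxS
  refine ⟨U ∩ {x | ¬ (x ∉ S → toFun v x = 0)},
    inter_mem (mem_nhdsWithin_of_mem_nhds hU) self_mem_nhdsWithin, ?_⟩
  refine measure_mono_null ?_ (ae_iff.1 hUv)
  rintro y ⟨hyU, hy⟩ hy'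
  exact hy fun _ => hy' hyU

/-! ### The space `H¹₀` of an open set, extended by zero -/

/-- `H10 Ω U` as a closed subspace. -/
def H10Submodule (Ω U : Set (Space d)) : Submodule ℝ (H1 Ω) :=
  Submodule.topologicalClosure
    { carrier := {v | ∃ φ : Space d → Space d, ContDiff ℝ ∞ φ ∧ HasCompactSupport φ ∧
        tsupport φ ⊆ U ∩ Ω ∧ ∀ᵐ x ∂(volume.restrict Ω), toFun v x = φ x}
      zero_mem' := ⟨0, contDiff_const, HasCompactSupport.zero, by simp,
        Lp.coeFn_zero (Space d) 2 (volume.restrict Ω)⟩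
      add_mem' := by
        rintro a b ⟨φ, h1, h2, h3, h4⟩ ⟨ψ, k1, k2, k3, k4⟩
        refine ⟨φ + ψ, h1.add k1, h2.add k2,
          (tsupport_add φ ψ).trans (Set.union_subset h3 k3), ?_⟩
        filter_upwards [h4, k4, toFun_add a b] with x hx kx hab
        rw [hab, hx, kx, Pi.add_apply]
      smul_mem' := by
        rintro c a ⟨φ, h1, h2, h3, h4⟩
        have hs : Function.support (c • φ) ⊆ Function.support φ :=
          Function.support_const_smul_subset c φ
        refine ⟨c • φ, contDiff_const.smul h1, h2.mono hs, (closure_mono hs).trans h3, ?_⟩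
        filter_upwards [h4, Lp.coeFn_smul c (fieldL Ω a)] with x hx hc
        change (c • fieldL Ω a) x = _
        rw [hc, Pi.smul_apply, Pi.smul_apply, ← hx]
        rfl }

theorem toFun_ae_zero_of_mem_H10 {U S : Set (Space d)} (hS : MeasurableSet S) (hUS : U ⊆ S)
    {v : H1 Ω} (hv : v ∈ H10 Ω U) : ∀ᵐ x ∂(volume.restrict Ω), x ∉ S → toFun v x = 0 := by
  have hcl := (isClosed_setOf_ae_zero_on (E := Space d) (volume.restrict Ω) hS.compl).preimage
    (fieldL Ω).continuous
  refine closure_minimal ?_ hcl hv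
  rintro w ⟨φ, -, -, h3, h4⟩
  filter_upwards [h4] with x hx hxS
  exact hx.trans (image_eq_zero_of_notMem_tsupport fun h => hxS (hUS (h3 h).1))

theorem grad_ae_zero_of_mem_H10 {U S : Set (Space d)} (hΩ : IsOpen Ω) (hS : MeasurableSet S)
    (hUS : U ⊆ S) {v : H1 Ω} (hv : v ∈ H10 Ω U) :
    ∀ᵐ x ∂(volume.restrict Ω), x ∉ S → grad v x = 0 := by
  have hcl := (isClosed_setOf_ae_zero_on (E := EuclideanSpace ℝ (Fin d × Fin d))
    (volume.restrict Ω) hS.compl).preimage (gradL Ω).continuous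
  refine closure_minimal ?_ hcl hv
  rintro w ⟨φ, -, -, h3, h4⟩
  have h5 : ∀ᵐ x ∂(volume.restrict Ω), x ∈ (tsupport φ)ᶜ → grad w x = 0 := by
    refine grad_ae_zero_of_toFun_ae_zero hΩ (isClosed_tsupport φ).isOpen_compl ?_
    filter_upwards [h4] with x hx hxφ
    exact hx.trans (image_eq_zero_of_notMem_tsupport hxφ)
  filter_upwards [h5] with x hx hxS
  exact hx fun h => hxS (hUS (h3 h).1)

/-- A field that agrees with a smooth one of compact support in `Ω` has partial derivatives of mean
zero: its weak gradient vanishes off the support, and is tested with a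
cut-off function that is constant on the support. -/
theorem integral_grad_eq_zero_of_ae_eq_contDiff (hΩ : IsOpen Ω) {v : H1 Ω} {φ : Space d → Space d}
    (hφc : HasCompactSupport φ) (hφs : tsupport φ ⊆ Ω)
    (hv : ∀ᵐ x ∂(volume.restrict Ω), toFun v x = φ x) (i j : Fin d) :
    ∫ x in Ω, grad v x (i, j) = 0 := by
  obtain ⟨W, hWo, hφW, hWΩ, hWc⟩ := exists_open_between_and_isCompact_closure hφc hΩ hφs
  obtain ⟨ψ, h0, h1, -⟩ := exists_contMDiffMap_zero_one_nhds_of_isClosed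
    (modelWithCornersSelf ℝ (Space d)) (n := ⊤) hWo.isClosed_compl (isClosed_tsupport φ)
    (Set.disjoint_compl_left_iff_subset.2 hφW)
  have hψs : tsupport ψ ⊆ closure W := closure_mono fun x hx => by
    by_contra hxW
    exact hx (h0.self_of_nhdsSet x hxW)
  have hψ : ContDiff ℝ ∞ ψ := ψ.contMDiff.contDiff
  have h2 := v.2 ψ hψ (hWc.of_isClosed_subset (isClosed_tsupport _) hψs) (hψs.trans hWΩ) i j
  have h3 : ∫ x in Ω, toFun v x i * fderiv ℝ ψ x (EuclideanSpace.single j 1) = 0 := by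
    refine integral_eq_zero_of_ae ?_
    filter_upwards [hv] with x hx
    by_cases hxφ : x ∈ tsupport φ
    · have h4 : (ψ : Space d → ℝ) =ᶠ[𝓝 x] fun _ => 1 := (mem_nhdsSet_iff_forall.1 h1) x hxφ
      have h4' : fderiv ℝ ψ x = 0 := by rw [h4.fderiv_eq, fderiv_const_apply]
      rw [h4', zero_apply, mul_zero, Pi.zero_apply]
    · simp [hx, image_eq_zero_of_notMem_tsupport hxφ]
  have h5 : ∀ᵐ x ∂(volume.restrict Ω), x ∈ (tsupport φ)ᶜ → grad v x = 0 := by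
    refine grad_ae_zero_of_toFun_ae_zero hΩ (isClosed_tsupport φ).isOpen_compl ?_
    filter_upwards [hv] with x hx hxφ
    exact hx.trans (image_eq_zero_of_notMem_tsupport hxφ)
  have h6 : ∫ x in Ω, grad v x (i, j) = ∫ x in Ω, grad v x (i, j) * ψ x := by
    refine integral_congr_ae ?_
    filter_upwards [h5] with x hx
    by_cases hxφ : x ∈ tsupport φ
    · rw [h1.self_of_nhdsSet x hxφ, mul_one]
    · simp [hx hxφ]
  have h7 : (0 : ℝ) = - ∫ x in Ω, grad v x (i, j) * ψ x := h3.symm.trans h2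
  linarith

end Sobolev

/-! ### Mean-free parts of square-integrable functions -/

section MeanFree

variable {X : Type*} [MeasurableSpace X] (μ : Measure X) [IsFiniteMeasure μ]

theorem inner_const_one (f : Lp ℝ 2 μ) : inner ℝ (Lp.const 2 μ (1 : ℝ)) f = ∫ x, f x ∂μ := by
  rw [L2.inner_def]
  refine integral_congr_ae ?_
  filter_upwards [Lp.coeFn_const 2 μ (1 : ℝ)] with x hx
  rw [hx]
  simp

/-- The map `f ↦ f - ⨍ f` on `L²` of a finite measure. -/
def meanFreeL : Lp ℝ 2 μ →L[ℝ] Lp ℝ 2 μ :=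
  ContinuousLinearMap.id ℝ _ - ((μ.real Set.univ)⁻¹ • innerSL ℝ (Lp.const 2 μ (1 : ℝ))).smulRight
    (Lp.const 2 μ (1 : ℝ))

theorem meanFreeL_apply (f : Lp ℝ 2 μ) :
    meanFreeL μ f = f - (⨍ x, f x ∂μ) • Lp.const 2 μ (1 : ℝ) := by
  rw [average_eq, ← inner_const_one]
  rfl

theorem meanFreeL_ae (f : Lp ℝ 2 μ) : ∀ᵐ x ∂μ, meanFreeL μ f x = f x - ⨍ y, f y ∂μ := by
  rw [meanFreeL_apply]
  filter_upwards [Lp.coeFn_sub f ((⨍ x, f x ∂μ) • Lp.const 2 μ (1 : ℝ)),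
    Lp.coeFn_smul (⨍ x, f x ∂μ) (Lp.const 2 μ (1 : ℝ)), Lp.coeFn_const 2 μ (1 : ℝ)] with x h1 h2 h3
  rw [h1, Pi.sub_apply, h2, Pi.smul_apply, h3]
  simp

theorem inner_meanFreeL_of_integral_eq_zero (f : Lp ℝ 2 μ) {g : Lp ℝ 2 μ}
    (hg : ∫ x, g x ∂μ = 0) : inner ℝ (meanFreeL μ f) g = inner ℝ f g := by
  rw [meanFreeL_apply, inner_sub_left, real_inner_smul_left, inner_const_one, hg, mul_zero,
    sub_zero]

end MeanFree

/-! ### The cells of the mesh -/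

section Cells

variable {d : ℕ} {Ω : Set (Space d)}

theorem isCompact_cell (K : Finset (Space d)) : IsCompact (cell K) :=
  K.finite_toSet.isCompact_convexHull (𝕜 := ℝ)

theorem measurableSet_cell (K : Finset (Space d)) : MeasurableSet (cell K) :=
  (isCompact_cell K).measurableSet

theorem MacroMesh.ae_notMem_cell (T : MacroMesh Ω) {K L : Finset (Space d)} (hK : K ∈ T.cells)
    (hL : L ∈ T.cells) (hKL : K ≠ L) : ∀ᵐ x ∂(volume.restrict Ω), x ∈ cell K → x ∉ cell L := by
  refine ae_restrict_of_ae ?_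
  have hf : ∀ M : Finset (Space d), ∀ᵐ x : Space d, x ∉ frontier (cell M) := fun M =>
    measure_eq_zero_iff_ae_notMem.1 ((convex_convexHull ℝ (M : Set (Space d))).addHaar_frontier
      volume)
  have hi : ∀ (M : Finset (Space d)) (x : Space d), x ∈ cell M → x ∉ frontier (cell M) →
      x ∈ interior (cell M) := fun M x hx hx' => by
    by_contra h
    exact hx' ⟨subset_closure hx, h⟩
  filter_upwards [hf K, hf L] with x hxK hxL h1 h2
  exact Set.disjoint_left.1 (T.disjoint_interior K hK L hL hKL) (hi K x h1 hxK) (hi L x h2 hxL)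

theorem isClosed_macroStar (T : MacroMesh Ω) (p : Space d) : IsClosed (T.macroStar p) := by
  classical
  have : T.macroStar p = ⋃ K ∈ T.cells.filter (fun K => p ∈ cell K), cell K := by
    ext x
    simp [MacroMesh.macroStar, and_assoc]
  rw [this]
  exact isClosed_biUnion_finset fun K _ => (isCompact_cell K).isClosed

theorem MacroMesh.ae_notMem_macroStar (T : MacroMesh Ω) {K : Finset (Space d)} (hK : K ∈ T.cells)
    {p : Space d} (hp : p ∉ cell K) :
    ∀ᵐ x ∂(volume.restrict Ω), x ∈ cell K → x ∉ T.macroStar p := by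
  have h : ∀ᵐ x ∂(volume.restrict Ω), ∀ L ∈ T.cells, L ≠ K → x ∈ cell K → x ∉ cell L :=
    (ae_ball_iff T.cells.countable_toSet).2 fun L hL => by
      by_cases hLK : L = K
      · simp [hLK]
      · filter_upwards [T.ae_notMem_cell hK hL (Ne.symm hLK)] with x hx _ using hx
  filter_upwards [h] with x hx hxK ⟨L, hL, hpL, hxL⟩
  exact hx L hL (by rintro rfl; exact hp hpL) hxK hxL

theorem MacroMesh.integral_eq_sum (T : MacroMesh Ω) (hΩ : IsOpen Ω) {f : Space d → ℝ}
    (hf : Integrable f (volume.restrict Ω)) :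
    ∫ x in Ω, f x = ∑ K ∈ T.cells, ∫ x in cell K, f x ∂(volume.restrict Ω) := by
  have hcover : ∀ᵐ x ∂(volume.restrict Ω), x ∈ ⋃ K : T.cells, cell (K : Finset (Space d)) := by
    filter_upwards [ae_restrict_mem hΩ.measurableSet] with x hx
    have h1 : x ∈ ⋃ K ∈ T.cells, cell K := T.iUnion_eq ▸ subset_closure hx
    simpa using h1
  have hdisj : Pairwise (Function.onFun (AEDisjoint (volume.restrict Ω))
      fun K : T.cells => cell (K : Finset (Space d))) := fun K L hKL => by
    refine measure_eq_zero_iff_ae_notMem.2 ?_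
    filter_upwards [T.ae_notMem_cell K.2 L.2 fun h => hKL (Subtype.ext h)] with x hx hxKL
    exact hx hxKL.1 hxKL.2
  have h := integral_iUnion_ae
    (fun K : T.cells => (measurableSet_cell (K : Finset (Space d))).nullMeasurableSet) hdisj
    hf.integrableOn
  rw [Measure.restrict_eq_self_of_ae_mem hcover, tsum_fintype] at h
  rw [h]
  exact Finset.sum_coe_sort T.cells fun K => ∫ x in cell K, f x ∂(volume.restrict Ω)

/-! ### Restriction to a cell -/

/-- Lebesgue measure on `K ∩ Ω`. -/
abbrev cellMeasure (Ω : Set (Space d)) (K : Finset (Space d)) : Measure (Space d) :=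
  (volume.restrict Ω).restrict (cell K)

theorem cellMeasure_eq (Ω : Set (Space d)) (K : Finset (Space d)) :
    cellMeasure Ω K = volume.restrict (cell K ∩ Ω) :=
  Measure.restrict_restrict (measurableSet_cell K)

instance isFiniteMeasure_cellMeasure (Ω : Set (Space d)) (K : Finset (Space d)) :
    IsFiniteMeasure (cellMeasure Ω K) :=
  ⟨by
    rw [cellMeasure_eq, Measure.restrict_apply_univ]
    exact (measure_mono Set.inter_subset_left).trans_lt (isCompact_cell K).measure_lt_top⟩

/-- Restriction of pressures to `K ∩ Ω`. -/
def resL (Ω : Set (Space d)) (K : Finset (Space d)) : L2 Ω →L[ℝ] Lp ℝ 2 (cellMeasure Ω K) :=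
  LpToLpRestrictCLM (Space d) ℝ ℝ (volume.restrict Ω) 2 (cell K)

theorem resL_ae (K : Finset (Space d)) (f : L2 Ω) : resL Ω K f =ᵐ[cellMeasure Ω K] f :=
  LpToLpRestrictCLM_coeFn ℝ (cell K) f

theorem inner_resL (K : Finset (Space d)) (f g : L2 Ω) :
    inner ℝ (resL Ω K f) (resL Ω K g) = ∫ x, f x * g x ∂(cellMeasure Ω K) := by
  rw [L2.inner_def]
  refine integral_congr_ae ?_
  filter_upwards [resL_ae K f, resL_ae K g] with x hf hg
  rw [hf, hg]
  simp [mul_comm]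

theorem MacroMesh.inner_eq_sum (T : MacroMesh Ω) (hΩ : IsOpen Ω) (f g : L2 Ω) :
    inner ℝ f g = ∑ K ∈ T.cells, inner ℝ (resL Ω K f) (resL Ω K g) := by
  have hint : Integrable (fun x => f x * g x) (volume.restrict Ω) :=
    MemLp.integrable_mul (Lp.memLp f) (Lp.memLp g)
  simp_rw [inner_resL]
  rw [← T.integral_eq_sum hΩ hint, L2.inner_def]
  simp [mul_comm]

theorem resL_eq_zero {K : Finset (Space d)} {f : L2 Ω}
    (hf : ∀ᵐ x ∂(volume.restrict Ω), x ∈ cell K → f x = 0) : resL Ω K f = 0 := by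
  rw [Lp.eq_zero_iff_ae_eq_zero]
  exact (resL_ae K f).trans ((ae_restrict_iff' (measurableSet_cell K)).2 hf)

theorem divL_ae_zero_of_grad {S : Set (Space d)} {v : H1 Ω}
    (hv : ∀ᵐ x ∂(volume.restrict Ω), x ∈ S → grad v x = 0) :
    ∀ᵐ x ∂(volume.restrict Ω), x ∈ S → divL Ω v x = 0 := by
  filter_upwards [hv, divL_ae v] with x hx h1 hxS
  rw [h1, divergence]
  simp [hx hxS]

/-- The divergence theorem on a cell for fields of `H¹₀`. -/
theorem integral_resL_divL_eq_zero (hΩ : IsOpen Ω) {K : Finset (Space d)} {v : H1 Ω}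
    (hv : v ∈ H10 Ω (interior (cell K))) :
    ∫ x, resL Ω K (divL Ω v) x ∂(cellMeasure Ω K) = 0 := by
  let ℓ : H1 Ω →L[ℝ] ℝ := innerSL ℝ (Lp.const 2 (cellMeasure Ω K) (1 : ℝ)) ∘L resL Ω K ∘L divL Ω
  have hℓ : ∀ w : H1 Ω, ℓ w = ∫ x, resL Ω K (divL Ω w) x ∂(cellMeasure Ω K) := fun w =>
    inner_const_one _ _
  rw [← hℓ]
  refine closure_minimal (t := {w | ℓ w = 0}) ?_ (isClosed_singleton.preimage ℓ.continuous) hv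
  rintro w ⟨φ, h1, h2, h3, h4⟩
  have hgrad := grad_ae_zero_of_mem_H10 hΩ (measurableSet_cell K) interior_subset
    (subset_closure ⟨φ, h1, h2, h3, h4⟩)
  have hmem : ∀ i, MemLp (fun x => grad w x (i, i)) 2 (volume.restrict (cell K ∩ Ω)) := fun i =>
    ((EuclideanSpace.proj (𝕜 := ℝ) (i, i)).comp_memLp' (Lp.memLp (gradL Ω w))).mono_measure
      (Measure.restrict_mono_set _ Set.inter_subset_right)
  have hfin : IsFiniteMeasure (volume.restrict (cell K ∩ Ω)) := by
    rw [← cellMeasure_eq]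
    infer_instance
  rw [Set.mem_ofPred_eq, hℓ, integral_congr_ae ((resL_ae K _).trans
    (ae_restrict_of_ae (divL_ae w)))]
  simp only [divergence]
  rw [cellMeasure_eq, integral_finsetSum _ fun i _ => (hmem i).integrable (by norm_num)]
  refine Finset.sum_eq_zero fun i _ => ?_
  rw [← integral_grad_eq_zero_of_ae_eq_contDiff hΩ h2 (h3.trans Set.inter_subset_right) h4 i i,
    ← cellMeasure_eq, setIntegral_eq_integral_of_ae_compl_eq_zero]
  filter_upwards [hgrad] with x hx hxK
  simp [hx hxK]

/-! ### The correction on one cell -/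

/-- The inf-sup condition on a cell without the supremum: a bound `c` for the pairing of a mean-free
pressure with the divergences of unit fields bounds the pressure by `β⁻¹ c`. -/
theorem infSup_of_infSupStableOn {Vh : Submodule ℝ (H1 Ω)} {Qh : Submodule ℝ (L2 Ω)} {β : ℝ}
    {K : Finset (Space d)} (h : InfSupStableOn Vh Qh β K) {q : L2 Ω} (hq : q ∈ Qh) {c : ℝ}
    (hc : 0 ≤ c) (hb : ∀ v ∈ localVelocities Vh K,
      inner ℝ (meanFreeL _ (resL Ω K q)) (resL Ω K (divL Ω v)) ≤ c * ‖v‖) :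
    β * ‖meanFreeL _ (resL Ω K q)‖ ≤ c := by
  set m := meanFreeL _ (resL Ω K q)
  have hm : ∀ᵐ x ∂(cellMeasure Ω K), m x = q x - ⨍ y in cell K ∩ Ω, q y := by
    have hav : ⨍ y, resL Ω K q y ∂(cellMeasure Ω K) = ⨍ y in cell K ∩ Ω, q y := by
      rw [← cellMeasure_eq]
      exact average_congr (resL_ae K q)
    filter_upwards [meanFreeL_ae _ (resL Ω K q), resL_ae K q] with x h1 h2
    rw [h1, h2, hav]
  have h1 := h _ ⟨q, hq, rfl⟩
  have hnorm : Real.sqrt (∫ x in cell K ∩ Ω, (q x - ⨍ y in cell K ∩ Ω, q y) ^ 2) = ‖m‖ := by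
    rw [← Real.sqrt_sq (norm_nonneg m), ← real_inner_self_eq_norm_sq, L2.inner_def,
      ← cellMeasure_eq]
    congr 1
    refine integral_congr_ae ?_
    filter_upwards [hm] with x hx
    rw [hx, cellMeasure_eq]
    simp [sq]
  rw [hnorm] at h1
  refine h1.trans ?_
  have : Nonempty (localVelocities Vh K) :=
    ⟨⟨0, Vh.zero_mem, (H10Submodule Ω (interior (cell K))).zero_mem⟩⟩
  refine ciSup_le fun v => ?_
  have hv : ∫ x in cell K ∩ Ω, (q x - ⨍ y in cell K ∩ Ω, q y) * divergence (v : H1 Ω) x =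
      inner ℝ m (resL Ω K (divL Ω v)) := by
    rw [L2.inner_def, ← cellMeasure_eq]
    refine integral_congr_ae ?_
    filter_upwards [hm, resL_ae K (divL Ω v), ae_restrict_of_ae (divL_ae (v : H1 Ω))] with x a b c
    rw [a, b, c, cellMeasure_eq]
    simp [mul_comm]
  rw [hv]
  -- For `v = 0` this is `0 ≤ c`, by the convention for division by zero.
  exact div_le_of_le_mul₀ (norm_nonneg _) hc (hb v v.2)

/-- On a cell, a prescribed divergence can be matched against `Q_h(K)` by a field of `V_{h,0}(K)`,
linearly and with constant `β⁻¹`. -/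
theorem exists_cellCorrection {Vh : Submodule ℝ (H1 Ω)} {Qh : Submodule ℝ (L2 Ω)}
    [FiniteDimensional ℝ Vh] [FiniteDimensional ℝ Qh] {β : ℝ} (hβ : 0 < β)
    {K : Finset (Space d)} (h : InfSupStableOn Vh Qh β K) :
    ∃ R : Lp ℝ 2 (cellMeasure Ω K) →L[ℝ] Vh,
      (∀ f, (R f : H1 Ω) ∈ H10 Ω (interior (cell K))) ∧
      (∀ f, ∀ q ∈ Qh, inner ℝ (meanFreeL _ (resL Ω K q)) (resL Ω K (divL Ω (R f))) =
        inner ℝ (meanFreeL _ (resL Ω K q)) f) ∧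
      ∀ f, ‖R f‖ ≤ β⁻¹ * ‖f‖ := by
  exact exists_rightInverse_of_infSup_on (resL Ω K ∘L divL Ω) Vh
    (H10Submodule Ω (interior (cell K))) (meanFreeL (cellMeasure Ω K) ∘L resL Ω K) Qh hβ
    fun q hq c hc hb => infSup_of_infSupStableOn h hq hc fun v hv => hb v hv.1 hv.2

end Cells

/-! ### Summing the corrections -/

/-- Norm of an operator `J` between subspaces of `H`, corrected on its residual by `R ∘ D`. -/
theorem opNorm_add_comp_residual_le {H G : Type*} [SeminormedAddCommGroup H] [NormedSpace ℝ H]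
    [SeminormedAddCommGroup G] [NormedSpace ℝ G] {U V : Submodule ℝ H} (J : U →L[ℝ] V)
    (R : G →L[ℝ] V) (D : H →L[ℝ] G) {a b : ℝ} (ha : 0 ≤ a) (hb : 0 ≤ b)
    (hD : ∀ v, ‖D v‖ ≤ a * ‖v‖) (hR : ∀ f, ‖R f‖ ≤ b * ‖f‖) :
    ‖J + R ∘L D ∘L (U.subtypeL - V.subtypeL ∘L J)‖ ≤ ‖J‖ + b * (a * (1 + ‖J‖)) := by
  refine ContinuousLinearMap.opNorm_le_bound _ (by positivity) fun v => ?_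
  have h1 : ‖J v‖ ≤ ‖J‖ * ‖v‖ := J.le_opNorm v
  have h2 : ‖(v : H) - J v‖ ≤ (1 + ‖J‖) * ‖v‖ := by
    have h3 : ‖(v : H) - J v‖ ≤ ‖v‖ + ‖J v‖ := norm_sub_le _ _
    linarith
  calc ‖J v + R (D ((v : H) - J v))‖ ≤ ‖J v‖ + ‖R (D ((v : H) - J v))‖ := norm_add_le _ _
    _ ≤ ‖J‖ * ‖v‖ + b * (a * ((1 + ‖J‖) * ‖v‖)) := by
        gcongr
        refine (hR _).trans ?_
        gcongr
        refine (hD _).trans ?_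
        gcongr
    _ = (‖J‖ + b * (a * (1 + ‖J‖))) * ‖v‖ := by ring

section Global

variable {d : ℕ} {Ω : Set (Space d)}

theorem inner_eq_zero_of_mem_H10 (hΩ : IsOpen Ω) (T : MacroMesh Ω) {K L : Finset (Space d)}
    (hK : K ∈ T.cells) (hL : L ∈ T.cells) (hKL : K ≠ L) {v w : H1 Ω}
    (hv : v ∈ H10 Ω (interior (cell K))) (hw : w ∈ H10 Ω (interior (cell L))) :
    inner ℝ v w = 0 := by
  have h := T.ae_notMem_cell hK hL hKL
  rw [inner_eq, L2.inner_def, L2.inner_def, integral_eq_zero_of_ae, integral_eq_zero_of_ae,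
    add_zero]
  · filter_upwards [h, grad_ae_zero_of_mem_H10 hΩ (measurableSet_cell K) interior_subset hv,
      grad_ae_zero_of_mem_H10 hΩ (measurableSet_cell L) interior_subset hw] with x hx hxv hxw
    rw [← grad_eq_gradL, ← grad_eq_gradL]
    by_cases hxK : x ∈ cell K
    · simp [hxw (hx hxK)]
    · simp [hxv hxK]
  · filter_upwards [h, toFun_ae_zero_of_mem_H10 (measurableSet_cell K) interior_subset hv,
      toFun_ae_zero_of_mem_H10 (measurableSet_cell L) interior_subset hw] with x hx hxv hxw
    rw [← toFun_eq_fieldL, ← toFun_eq_fieldL]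
    by_cases hxK : x ∈ cell K
    · simp [hxw (hx hxK)]
    · simp [hxv hxK]

theorem norm_sum_sq_of_mem_H10 (hΩ : IsOpen Ω) (T : MacroMesh Ω) (u : Finset (Space d) → H1 Ω)
    (hu : ∀ K ∈ T.cells, u K ∈ H10 Ω (interior (cell K))) :
    ‖∑ K ∈ T.cells, u K‖ ^ 2 = ∑ K ∈ T.cells, ‖u K‖ ^ 2 := by
  rw [← real_inner_self_eq_norm_sq, sum_inner]
  refine Finset.sum_congr rfl fun K hK => ?_
  rw [inner_sum, Finset.sum_eq_single_of_mem K hK fun L hL hLK =>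
    inner_eq_zero_of_mem_H10 hΩ T hK hL hLK.symm (hu K hK) (hu L hL), real_inner_self_eq_norm_sq]

/-- The global operator: the correction on `K` is computed from the restriction of `f` to `K`.
Fields from different cells are orthogonal, so the bound does not involve the number of cells. -/
theorem exists_correction (hΩ : IsOpen Ω) (T : MacroMesh Ω) {Vh : Submodule ℝ (H1 Ω)}
    {Qh : Submodule ℝ (L2 Ω)} [FiniteDimensional ℝ Vh] [FiniteDimensional ℝ Qh] {β : ℝ}
    (hβ : 0 < β) (h : ∀ K ∈ T.cells, InfSupStableOn Vh Qh β K) :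
    ∃ R : L2 Ω →L[ℝ] Vh,
      (∀ f, (∀ K ∈ T.cells, ∫ x, resL Ω K f x ∂(cellMeasure Ω K) = 0) → ∀ q ∈ Qh,
        inner ℝ q (divL Ω (R f)) = inner ℝ q f) ∧
      (∀ f p, (∀ K ∈ T.cells, p ∉ cell K → resL Ω K f = 0) →
        supp (R f : H1 Ω) ⊆ T.macroStar p) ∧
      ∀ f, ‖R f‖ ≤ β⁻¹ * ‖f‖ := by
  classical
  choose! R hR0 hRd hRn using fun K (hK : K ∈ T.cells) => exists_cellCorrection hβ (h K hK)
  let S : L2 Ω →L[ℝ] Vh := ∑ K ∈ T.cells, R K ∘L resL Ω K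
  have hS : ∀ f, (S f : H1 Ω) = ∑ K ∈ T.cells, (R K (resL Ω K f) : H1 Ω) := fun f => by
    simp [S]
  refine ⟨S, fun f hf q hq => ?_, fun f p hf => ?_, fun f => ?_⟩
  · rw [hS, map_sum, inner_sum, T.inner_eq_sum hΩ q f]
    refine Finset.sum_congr rfl fun K hK => ?_
    have hdiv := integral_resL_divL_eq_zero hΩ (hR0 K hK (resL Ω K f))
    -- The divergence of the correction on `K` vanishes on the other cells, and on `K` both sides
    -- have mean zero, so only the mean-free part of `q` matters.
    rw [T.inner_eq_sum hΩ, Finset.sum_eq_single_of_mem K hK,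
      ← inner_meanFreeL_of_integral_eq_zero _ _ hdiv, hRd K hK _ q hq,
      inner_meanFreeL_of_integral_eq_zero _ _ (hf K hK)]
    intro L hL hLK
    rw [resL_eq_zero (f := divL Ω (R K (resL Ω K f) : H1 Ω)), inner_zero_right]
    filter_upwards [T.ae_notMem_cell hL hK hLK, divL_ae_zero_of_grad (S := (cell K)ᶜ)
      (grad_ae_zero_of_mem_H10 hΩ (measurableSet_cell K) interior_subset
        (hR0 K hK (resL Ω K f)))] with x h1 h2 hxL
    exact h2 (h1 hxL)
  · refine supp_subset_of_ae_zero (isClosed_macroStar T p) ?_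
    let Z : Submodule ℝ (H1 Ω) :=
      { carrier := {v | ∀ᵐ x ∂(volume.restrict Ω), x ∉ T.macroStar p → toFun v x = 0}
        zero_mem' := by
          filter_upwards [Lp.coeFn_zero (Space d) 2 (volume.restrict Ω)] with x hx _ using hx
        add_mem' := fun {a b} ha hb => by
          filter_upwards [ha, hb, toFun_add a b] with x h1 h2 h3 hx
          rw [h3, h1 hx, h2 hx, add_zero]
        smul_mem' := fun c a ha => by
          filter_upwards [ha, Lp.coeFn_smul c (fieldL Ω a)] with x h1 h3 hx
          refine h3.trans ?_
          rw [Pi.smul_apply, ← toFun_eq_fieldL, h1 hx, smul_zero] }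
    change (S f : H1 Ω) ∈ Z
    rw [hS]
    refine Z.sum_mem fun K hK => ?_
    by_cases hp : p ∈ cell K
    · change ∀ᵐ x ∂(volume.restrict Ω), _
      filter_upwards [toFun_ae_zero_of_mem_H10 (measurableSet_cell K) interior_subset
        (hR0 K hK (resL Ω K f))] with x hx hxp
      exact hx fun hxK => hxp ⟨K, hK, hp, hxK⟩
    · rw [hf K hK hp, map_zero]
      exact Z.zero_mem
  · have h1 : ‖S f‖ ^ 2 ≤ (β⁻¹ * ‖f‖) ^ 2 := by
      calc ‖S f‖ ^ 2 = ∑ K ∈ T.cells, ‖R K (resL Ω K f)‖ ^ 2 := by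
            change ‖(S f : H1 Ω)‖ ^ 2 = _
            rw [hS]
            exact norm_sum_sq_of_mem_H10 hΩ T _ fun K hK => hR0 K hK _
        _ ≤ ∑ K ∈ T.cells, (β⁻¹ * ‖resL Ω K f‖) ^ 2 :=
            Finset.sum_le_sum fun K hK => pow_le_pow_left₀ (norm_nonneg _) (hRn K hK _) 2
        _ = (β⁻¹ * ‖f‖) ^ 2 := by
            simp_rw [mul_pow, ← Finset.mul_sum, ← real_inner_self_eq_norm_sq]
            rw [← T.inner_eq_sum hΩ]
    exact (sq_le_sq₀ (norm_nonneg _) (by positivity)).1 h1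

theorem inner_divL (q : L2 Ω) (v : H1 Ω) :
    inner ℝ q (divL Ω v) = ∫ x in Ω, q x * divergence v x := by
  rw [L2.inner_def]
  refine integral_congr_ae ?_
  filter_upwards [divL_ae v] with x hx
  rw [hx]
  simp [mul_comm]

/-- An operator that preserves the divergence tested with piecewise constants preserves the mean
divergence on every cell. -/
theorem integral_resL_divL_sub_eq_zero {ΓD : Set (Space d)} (T : MacroMesh Ω)
    {Vh : Submodule ℝ (H1 Ω)} {I : velocitySpace Ω ΓD →L[ℝ] Vh}
    (hI : IsFortin I T.piecewiseConstant) (v : velocitySpace Ω ΓD) {K : Finset (Space d)}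
    (hK : K ∈ T.cells) :
    ∫ x, resL Ω K (divL Ω ((v : H1 Ω) - I v)) x ∂(cellMeasure Ω K) = 0 := by
  have hfin : volume.restrict Ω (cell K) ≠ ⊤ := by
    rw [← Measure.restrict_apply_univ]
    exact measure_ne_top (cellMeasure Ω K) _
  let q : L2 Ω := indicatorConstLp 2 (measurableSet_cell K) hfin (1 : ℝ)
  have hq : q ∈ T.piecewiseConstant := by
    intro L hL
    by_cases hLK : L = K
    · refine ⟨1, ?_⟩
      filter_upwards [indicatorConstLp_coeFn_mem (p := 2) (hs := measurableSet_cell K)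
        (hμs := hfin) (c := (1 : ℝ))] with x hx hxL
      exact hx (hLK ▸ hxL)
    · refine ⟨0, ?_⟩
      filter_upwards [T.ae_notMem_cell hL hK hLK, indicatorConstLp_coeFn_notMem (p := 2)
        (hs := measurableSet_cell K) (hμs := hfin) (c := (1 : ℝ))] with x h1 h2 hxL
      exact h2 (h1 hxL)
  have h1 : inner ℝ q (divL Ω ((v : H1 Ω) - I v)) = 0 := by
    rw [map_sub, inner_sub_right, inner_divL, inner_divL, hI.div_eq q hq v, sub_self]
  rw [integral_congr_ae (resL_ae K _), ← h1, L2.inner_indicatorConstLp_one]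

end Global

end MacroFortin

end

/-! ### The Fortin operator -/

set_option maxHeartbeats 1000000 in
theorem mainTheorem1 (d : ℕ) :
    ∃ C : ℝ → ℝ → ℝ,
      ∀ (Ω ΓD : Set (Space d)), IsOpen Ω → ΓD ⊆ frontier Ω →
      ∀ (T : MacroMesh Ω) (Vh : Submodule ℝ (H1 Ω)) (Qh : Submodule ℝ (L2 Ω)),
        FiniteDimensional ℝ Vh → FiniteDimensional ℝ Qh → Vh ≤ velocitySpace Ω ΓD →
      ∀ (Ωc : Space d → Set (Space d)),
        Ω ⊆ ⋃ p ∈ T.vertices, Ωc p → (∀ p ∈ T.vertices, Ωc p ⊆ T.macroStar p) →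
      ∀ Itilde : velocitySpace Ω ΓD →L[ℝ] Vh,
        IsFortin Itilde T.piecewiseConstant → IsLocal T Ωc Itilde →
      ∀ β : ℝ, 0 < β → (∀ K ∈ T.cells, InfSupStableOn Vh Qh β K) →
      ∃ I : velocitySpace Ω ΓD →L[ℝ] Vh,
        IsFortin I Qh ∧ IsLocal T Ωc I ∧ ‖I‖ ≤ C β ‖Itilde‖ := by
  refine ⟨fun β c => c + β⁻¹ * (Real.sqrt d * (1 + c)), ?_⟩
  intro Ω ΓD hΩ _ T Vh Qh hVfin hQfin _ Ωc _ hΩc J hJ hJloc β hβ hinf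
  obtain ⟨R, hRdiv, hRsupp, hRn⟩ := exists_correction hΩ T hβ hinf
  let W : velocitySpace Ω ΓD →L[ℝ] H1 Ω := (velocitySpace Ω ΓD).subtypeL - Vh.subtypeL ∘L J
  have hW : ∀ v : velocitySpace Ω ΓD, W v = (v : H1 Ω) - J v := fun _ => rfl
  refine ⟨J + R ∘L divL Ω ∘L W, ⟨fun q hq v => ?_, fun v hv => ?_⟩, fun p hp v hv => ?_, ?_⟩
  · have h1 := hRdiv (divL Ω (W v)) (fun K hK => integral_resL_divL_sub_eq_zero T hJ v hK) q hq
    rw [← inner_divL, ← inner_divL]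
    change inner ℝ q (divL Ω ((J v : H1 Ω) + (R (divL Ω (W v)) : H1 Ω))) = _
    rw [map_add, inner_add_right, h1, hW, map_sub, inner_sub_right]
    ring
  · have h1 : W v = 0 := by rw [hW, hJ.proj v hv, sub_self]
    change (J v : H1 Ω) + (R (divL Ω (W v)) : H1 Ω) = v
    rw [h1, map_zero, map_zero, Submodule.coe_zero, add_zero, hJ.proj v hv]
  · have hJv := hJloc p hp v hv
    refine ⟨((J + R ∘L divL Ω ∘L W) v).2, ?_⟩
    have hv0 := ae_zero_of_supp_subset (hv.trans (hΩc p hp))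
    have hJ0 := ae_zero_of_supp_subset hJv.2
    have hW0 : ∀ᵐ x ∂(volume.restrict Ω), x ∈ (T.macroStar p)ᶜ → toFun (W v) x = 0 := by
      filter_upwards [hv0, hJ0, toFun_sub (v : H1 Ω) (J v : H1 Ω)] with x h1 h2 h3 hx
      rw [hW, h3, h1 hx, h2 hx, sub_zero]
    have hdiv0 := divL_ae_zero_of_grad (grad_ae_zero_of_toFun_ae_zero hΩ
      (isClosed_macroStar T p).isOpen_compl hW0)
    -- A cell outside the star meets the star in a null set, so no correction is made there.
    have hR0 := ae_zero_of_supp_subset (hRsupp (divL Ω (W v)) p fun K hK hpK => resL_eq_zero (by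
      filter_upwards [T.ae_notMem_macroStar hK hpK, hdiv0] with x h1 h2 hxK
      exact h2 (h1 hxK)))
    refine supp_subset_of_ae_zero (isClosed_macroStar T p) ?_
    filter_upwards [hJ0, hR0, toFun_add (J v : H1 Ω) (R (divL Ω (W v)) : H1 Ω)] with x h1 h2 h3 hx
    refine h3.trans ?_
    rw [h1 hx, h2 hx, add_zero]
  · exact opNorm_add_comp_residual_le J R (divL Ω) (Real.sqrt_nonneg _) (inv_nonneg.2 hβ.le)
      norm_divL_le hRn
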